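/- **Definitions.** Let $A$ be a separable C*-algebra (not necessarily unital). An irreducible representation of $A$ is a nonzero $*$-homomorphism $\rho:A\to B(H)$, with $H$ a complex Hilbert space, that has no closed invariant subspaces other than $0$ and $H$. $\mathrm{Prim}(A)$ is the set of kernels of irreducible representations of $A$, with the Jacobson topology: the closed sets are the sets $\{t\in\mathrm{Prim}(A): I\subseteq t\}$, where $I$ ranges over the closed two-sided ideals of $A$. $A$ is *preliminary* if it has no infinite-dimensional irreducible representation. Let $X$ be a topological space and $w:X\to\mathbb N\cup\{\infty\}$ a function. The *order* $o_w(x)$ of $x\in X$ is defined by recursion: $o_w(x)$ is the least ordinal $\alpha$ for which there are a neighbourhood $U$ of $x$ and $n\in\mathbb N$ such that every $y\in U$ satisfies $o_w(y)<\alpha$ or $w(y)\le n$; if there is no such $\alpha$ (in particular if $w(x)=\infty$), then $o_w(x)=\infty$. Thus $o_w(x)=0$ if and only if $w$ is bounded by a natural number in a neighbourhood of $x$. The *rank* of $x$ is $r_w(x)=\omega\cdot o_w(x)+w(x)$ if $o_w(x)<\infty$, and $r_w(x)=\infty$ otherwise; the rank of $w$ is $r(w)=\sup_{x\in X}r_w(x)$.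 (Equivalently, $o_w(x)=\alpha$ if and only if $w(x)<\infty$, there are a neighbourhood $U$ of $x$ and $n\in\mathbb N$ with $r_w(y)\le\omega\alpha+n$ for all $y\in U$, and for every $\beta<\omega\alpha$ and every neighbourhood $W$ of $x$ there is $y\in W\setminus\{x\}$ with $r_w(y)>\beta$.) For $a\in A$ let $w_a:\mathrm{Prim}(A)\to\mathbb N\cup\{\infty\}$ be the function $\ker\rho\mapsto\mathrm{rank}(\rho(a))$, which does not depend on the choice of $\rho$ with the given kernel. The *Pedersen rank* of $a$ is $r(w_a)$, the Pedersen rank of $A$ is the supremum of the Pedersen ranks of its elements, and $A$ is *$\alpha$-subhomogeneous* if its Pedersen rank is at most $\alpha$. **Theorem.** Let $A$ be a separable C*-algebra. Then $A$ is preliminary if and only if it is $\alpha$-subhomogeneous for some countable ordinal $\alpha$. Equivalently, $A$ is preliminary if and only if its Pedersen rank is a countable ordinal (that is, less than $\omega_1$). -/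

import Mathlib

open scoped Ordinal

universe u

namespace PedersenRank

/-! ### Order and rank of an extended-natural-valued function -/

section Weight

variable {X : Type u} [TopologicalSpace X]

/-- `orderLE w α` is the set of points of order at most `α` with respect to `w`. A point `x` is in
it when some neighbourhood `U` of `x` and some natural number `n` are such that every `y ∈ U`
has order less than `α` or satisfies `w y ≤ n`. For `α = 0` this says that `w` is bounded by a
natural number near `x`. -/
def orderLE (w : X → ℕ∞) (α : Ordinal.{u}) : Set X :=
  {x | ∃ U ∈ nhds x, ∃ n : ℕ, ∀ y ∈ U, (∃ β, ∃ _ : β < α, y ∈ orderLE w β) ∨ w y ≤ n}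
termination_by α

/-- The order `o_w(x)`: the least `α` such that `x` has order at most `α`, and `⊤` (that is, `∞`)
if there is none. -/
noncomputable def weightOrder (w : X → ℕ∞) (x : X) : WithTop Ordinal.{u} :=
  ⨅ α : {α : Ordinal.{u} // x ∈ orderLE w α}, ((α : Ordinal.{u}) : WithTop Ordinal.{u})

theorem mem_orderLE {w : X → ℕ∞} {α : Ordinal.{u}} {x : X} :
    x ∈ orderLE w α ↔
      ∃ U ∈ nhds x, ∃ n : ℕ, ∀ y ∈ U, (∃ β < α, y ∈ orderLE w β) ∨ w y ≤ n := by
  rw [orderLE, Set.mem_ofPred_eq]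
  simp only [exists_prop]

theorem orderLE_mono {w : X → ℕ∞} {α β : Ordinal.{u}} (h : α ≤ β) {x : X}
    (hx : x ∈ orderLE w α) : x ∈ orderLE w β := by
  rw [mem_orderLE] at hx ⊢
  obtain ⟨U, hU, n, hn⟩ := hx
  refine ⟨U, hU, n, fun y hy => (hn y hy).imp_left ?_⟩
  rintro ⟨γ, hγ, hyγ⟩
  exact ⟨γ, hγ.trans_le h, hyγ⟩

theorem ne_top_of_mem_orderLE {w : X → ℕ∞} {x : X} (α : Ordinal.{u}) :
    x ∈ orderLE w α → w x ≠ ⊤ := by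
  induction α using WellFoundedLT.induction with
  | ind α ih =>
    intro hx
    obtain ⟨U, hU, n, hn⟩ := mem_orderLE.1 hx
    rcases hn x (mem_of_mem_nhds hU) with ⟨β, hβ, h⟩ | h
    · exact ih β hβ h
    · exact ne_top_of_le_ne_top (ENat.natCast_ne_top n) h

theorem weightOrder_le_iff {w : X → ℕ∞} {x : X} {α : Ordinal.{u}} :
    weightOrder w x ≤ α ↔ x ∈ orderLE w α := by
  constructor
  · intro h
    by_contra hx
    have h1 : ((Order.succ α : Ordinal.{u}) : WithTop Ordinal.{u}) ≤ weightOrder w x := by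
      refine le_iInf fun β => ?_
      rw [WithTop.coe_le_coe, Order.succ_le_iff]
      by_contra hβ
      exact hx (orderLE_mono (not_lt.1 hβ) β.2)
    have h2 := WithTop.coe_le_coe.1 (h1.trans h)
    exact absurd (Order.lt_succ α) (not_lt.2 h2)
  · intro hx
    exact iInf_le (fun β : {β : Ordinal.{u} // x ∈ orderLE w β} =>
      ((β : Ordinal.{u}) : WithTop Ordinal.{u})) ⟨α, hx⟩

theorem weightOrder_eq_top {w : X → ℕ∞} {x : X} (h : w x = ⊤) : weightOrder w x = ⊤ := by
  by_contra hne
  obtain ⟨α, hα⟩ := WithTop.ne_top_iff_exists.1 hne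
  exact ne_top_of_mem_orderLE α (weightOrder_le_iff.1 hα.ge) h

/-- The rank `r_w(x) = ω · o_w(x) + w(x)` of a point, which is `⊤` if `o_w(x) = ⊤`. (If
`w x = ⊤` then `o_w(x) = ⊤`, see `weightOrder_eq_top`, so the junk value of `toNat` is not used.) -/
noncomputable def weightRank (w : X → ℕ∞) (x : X) : WithTop Ordinal.{u} :=
  WithTop.map (fun α : Ordinal.{u} => ω * α + ((w x).toNat : Ordinal.{u})) (weightOrder w x)

theorem weightRank_le_iff {w : X → ℕ∞} {x : X} {α : Ordinal.{u}} {n : ℕ} :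
    weightRank w x ≤ ((ω * α + n : Ordinal.{u}) : WithTop Ordinal.{u}) ↔
      (∃ β < α, x ∈ orderLE w β) ∨ (x ∈ orderLE w α ∧ w x ≤ n) := by
  have key : ∀ {a b : Ordinal.{u}} (k : ℕ), a < b → ω * a + (k : Ordinal.{u}) < ω * b := by
    intro a b k hab
    calc ω * a + (k : Ordinal.{u}) < ω * a + ω := by
          gcongr
          exact Ordinal.natCast_lt_omega0 k
      _ = ω * Order.succ a := (Ordinal.mul_succ _ _).symm
      _ ≤ ω * b := by
          gcongr
          exact Order.succ_le_of_lt hab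
  rcases eq_or_ne (weightOrder w x) ⊤ with ht | ht
  · have hno : ∀ β : Ordinal.{u}, x ∉ orderLE w β := by
      intro β hβ
      have := weightOrder_le_iff.2 hβ
      rw [ht] at this
      exact absurd this (by simp)
    refine iff_of_false ?_ ?_
    · rw [weightRank, ht, WithTop.map_top, top_le_iff]
      exact WithTop.coe_ne_top
    · rintro (⟨β, -, h⟩ | ⟨h, -⟩)
      · exact hno β h
      · exact hno α h
  · obtain ⟨γ, hγ⟩ := WithTop.ne_top_iff_exists.1 ht
    have hmem : ∀ β : Ordinal.{u}, x ∈ orderLE w β ↔ γ ≤ β := by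
      intro β
      rw [← weightOrder_le_iff, ← hγ, WithTop.coe_le_coe]
    have hfin : w x ≠ ⊤ := ne_top_of_mem_orderLE γ ((hmem γ).2 le_rfl)
    obtain ⟨k, hk⟩ := ENat.ne_top_iff_exists.1 hfin
    simp only [weightRank, ← hγ, WithTop.map_coe, WithTop.coe_le_coe, hmem, ← hk, ENat.toNat_natCast,
      Nat.cast_le]
    rcases lt_trichotomy γ α with h | h | h
    · refine iff_of_true ?_ (Or.inl ⟨γ, h, le_rfl⟩)
      exact (key k h).le.trans le_self_add
    · subst h
      constructor
      · intro h'
        exact Or.inr ⟨le_rfl, by exact_mod_cast (add_le_add_iff_left _).1 h'⟩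
      · rintro (⟨β, hβ, hle⟩ | ⟨-, h'⟩)
        · exact absurd hβ (not_lt.2 hle)
        · gcongr
    · refine iff_of_false ?_ ?_
      · exact not_le.2 ((key n h).trans_le le_self_add)
      · rintro (⟨β, hβ, hle⟩ | ⟨hle, -⟩)
        · exact absurd (h.trans_le hle) (not_lt.2 hβ.le)
        · exact absurd h (not_lt.2 hle)

/-- The recursive description of the order: `o_w(x) = α` if and only if `w x` is finite, the ranks
near `x` are at most `ω · α + n` for some natural number `n`, and for every `β < ω · α` there are
points other than `x` and arbitrarily close to `x` of rank greater than `β`. -/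
theorem weightOrder_eq_iff {w : X → ℕ∞} {x : X} {α : Ordinal.{u}} :
    weightOrder w x = α ↔ w x ≠ ⊤ ∧
      (∃ U ∈ nhds x, ∃ n : ℕ, ∀ y ∈ U,
        weightRank w y ≤ ((ω * α + n : Ordinal.{u}) : WithTop Ordinal.{u})) ∧
      ∀ β < ω * α, ∀ W ∈ nhds x, ∃ y ∈ W, y ≠ x ∧
        (β : WithTop Ordinal.{u}) < weightRank w y := by
  have upper : ∀ γ : Ordinal.{u}, x ∈ orderLE w γ ↔ ∃ U ∈ nhds x, ∃ n : ℕ, ∀ y ∈ U,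
      weightRank w y ≤ ((ω * γ + n : Ordinal.{u}) : WithTop Ordinal.{u}) := by
    intro γ
    constructor
    · intro hx
      obtain ⟨U, hU, n, hn⟩ := mem_orderLE.1 hx
      refine ⟨interior U, interior_mem_nhds.2 hU, n, fun y hy => weightRank_le_iff.2 ?_⟩
      refine (hn y (interior_subset hy)).imp_right fun h => ⟨?_, h⟩
      exact mem_orderLE.2 ⟨U, mem_interior_iff_mem_nhds.1 hy, n, hn⟩
    · rintro ⟨U, hU, n, hn⟩
      refine mem_orderLE.2 ⟨U, hU, n, fun y hy => ?_⟩
      exact (weightRank_le_iff.1 (hn y hy)).imp_right And.right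
  constructor
  · intro h
    have hx : x ∈ orderLE w α := weightOrder_le_iff.1 h.le
    have hfin := ne_top_of_mem_orderLE α hx
    refine ⟨hfin, (upper α).1 hx, fun β hβ W hW => ?_⟩
    by_contra! hcon
    have hγ : β / ω < α := (Ordinal.lt_mul_iff_div_lt Ordinal.omega0_ne_zero).1 hβ
    obtain ⟨n, hn⟩ := Ordinal.lt_omega0.1 (Ordinal.mod_lt β Ordinal.omega0_ne_zero)
    obtain ⟨k, hk⟩ := ENat.ne_top_iff_exists.1 hfin
    have hβn : β = ω * (β / ω) + (n : Ordinal.{u}) := by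
      rw [← hn]
      exact (Ordinal.div_add_mod β ω).symm
    have hmem : x ∈ orderLE w (β / ω) := by
      refine mem_orderLE.2 ⟨W, hW, max n k, fun y hy => ?_⟩
      by_cases hyx : y = x
      · right
        rw [hyx, ← hk]
        exact_mod_cast le_max_right n k
      · have h1 := hcon y hy hyx
        rw [hβn] at h1
        refine (weightRank_le_iff.1 h1).imp_right fun h2 => h2.2.trans ?_
        exact_mod_cast le_max_left n k
    have h3 := weightOrder_le_iff.2 hmem
    rw [h, WithTop.coe_le_coe] at h3
    exact absurd hγ (not_lt.2 h3)
  · rintro ⟨-, hup, hlow⟩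
    refine le_antisymm (weightOrder_le_iff.2 ((upper α).2 hup)) ?_
    by_contra hlt
    rw [not_le] at hlt
    obtain ⟨γ, hγ⟩ := WithTop.ne_top_iff_exists.1 hlt.ne_top
    rw [← hγ, WithTop.coe_lt_coe] at hlt
    obtain ⟨U, hU, n, hn⟩ := (upper γ).1 (weightOrder_le_iff.1 hγ.ge)
    have hb : ω * γ + (n : Ordinal.{u}) < ω * α := by
      calc ω * γ + (n : Ordinal.{u}) < ω * γ + ω := by
            gcongr
            exact Ordinal.natCast_lt_omega0 n
        _ = ω * Order.succ γ := (Ordinal.mul_succ _ _).symm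
        _ ≤ ω * α := by
            gcongr
            exact Order.succ_le_of_lt hlt
    obtain ⟨y, hy, -, hlt'⟩ := hlow _ hb U hU
    exact absurd (hn y hy) (not_le.2 hlt')

/-- If all points other than `x` near `x` have order less than `α`, and for every `β < ω · α` there
are such points arbitrarily close to `x` of rank greater than `β`, then `x` has order `α`. -/
theorem weightOrder_eq_of_punctured {w : X → ℕ∞} {x : X} {α : Ordinal.{u}} (hx : w x ≠ ⊤)
    (hup : ∃ U ∈ nhds x, ∀ y ∈ U, y ≠ x → weightOrder w y < α)
    (hlow : ∀ β < ω * α, ∀ W ∈ nhds x, ∃ y ∈ W, y ≠ x ∧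
      (β : WithTop Ordinal.{u}) < weightRank w y) : weightOrder w x = α := by
  obtain ⟨U, hU, h⟩ := hup
  obtain ⟨k, hk⟩ := ENat.ne_top_iff_exists.1 hx
  have hmem : x ∈ orderLE w α := by
    refine mem_orderLE.2 ⟨U, hU, k, fun y hy => ?_⟩
    by_cases hyx : y = x
    · right
      rw [hyx, hk]
    · left
      obtain ⟨γ, hγ⟩ := WithTop.ne_top_iff_exists.1 (h y hy hyx).ne_top
      refine ⟨γ, ?_, weightOrder_le_iff.1 hγ.ge⟩
      have := h y hy hyx
      rwa [← hγ, WithTop.coe_lt_coe] at this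
  refine le_antisymm (weightOrder_le_iff.2 hmem) (not_lt.1 fun hlt => ?_)
  obtain ⟨γ, hγ⟩ := WithTop.ne_top_iff_exists.1 hlt.ne_top
  obtain ⟨-, ⟨V, hV, n, hn⟩, -⟩ := weightOrder_eq_iff.1 hγ.symm
  rw [← hγ, WithTop.coe_lt_coe] at hlt
  have hb : ω * γ + (n : Ordinal.{u}) < ω * α := by
    calc ω * γ + (n : Ordinal.{u}) < ω * γ + ω := by
          gcongr
          exact Ordinal.natCast_lt_omega0 n
      _ = ω * Order.succ γ := (Ordinal.mul_succ _ _).symm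
      _ ≤ ω * α := by
          gcongr
          exact Order.succ_le_of_lt hlt
  obtain ⟨y, hy, -, hlt'⟩ := hlow _ hb V hV
  exact absurd (hn y hy) (not_le.2 hlt')

/-- The rank `r(w)` of a function: the supremum of the ranks of the points. -/
noncomputable def functionRank (w : X → ℕ∞) : WithTop Ordinal.{u} :=
  ⨆ x, weightRank w x

end Weight

/-! ### Irreducible representations and the primitive spectrum -/

/-- An irreducible representation of a C*-algebra on a complex Hilbert space: a nonzero
*-homomorphism into the bounded operators whose only closed invariant subspaces are the trivial
ones. (By the GNS construction, every irreducible representation of `A : Type u` is unitarily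
equivalent to one on a Hilbert space in `Type u`.) -/
structure IrreducibleRep (A : Type u) [NonUnitalCStarAlgebra A] where
  H : Type u
  [normedAddCommGroup : NormedAddCommGroup H]
  [innerProductSpace : InnerProductSpace ℂ H]
  [completeSpace : CompleteSpace H]
  toHom : A →⋆ₙₐ[ℂ] (H →L[ℂ] H)
  nonzero : ∃ a, toHom a ≠ 0
  irreducible : ∀ K : Submodule ℂ H, IsClosed (K : Set H) →
    (∀ a, ∀ v ∈ K, toHom a v ∈ K) → K = ⊥ ∨ K = ⊤

attribute [instance] IrreducibleRep.normedAddCommGroup IrreducibleRep.innerProductSpace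
  IrreducibleRep.completeSpace

variable {A : Type u} [NonUnitalCStarAlgebra A]

/-- The kernel of an irreducible representation, as a two-sided ideal. -/
noncomputable def IrreducibleRep.kernel (π : IrreducibleRep A) : TwoSidedIdeal A :=
  TwoSidedIdeal.ker π.toHom

theorem IrreducibleRep.mem_kernel {π : IrreducibleRep A} {a : A} :
    a ∈ π.kernel ↔ π.toHom a = 0 :=
  TwoSidedIdeal.mem_ker π.toHom

theorem IrreducibleRep.kernel_prime (π : IrreducibleRep A) {I J : TwoSidedIdeal A}
    (h : I ⊓ J ≤ π.kernel) : I ≤ π.kernel ∨ J ≤ π.kernel := by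
  let K : Submodule ℂ π.H := ⨅ i : I, LinearMap.ker (π.toHom (i : A)).toLinearMap
  have memK : ∀ v, v ∈ K ↔ ∀ i ∈ I, π.toHom i v = 0 := by
    intro v
    simp [K, Submodule.mem_iInf]
  have hcl : IsClosed (K : Set π.H) := by
    have : (K : Set π.H) = ⋂ i : I, {v | π.toHom (i : A) v = 0} := by
      ext v
      simp [memK]
    rw [this]
    exact isClosed_iInter fun i => isClosed_eq (π.toHom (i : A)).continuous continuous_const
  have hinv : ∀ a, ∀ v ∈ K, π.toHom a v ∈ K := by
    intro a v hv
    rw [memK] at hv ⊢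
    intro i hi
    have := hv (i * a) (I.mul_mem_right _ _ hi)
    simpa [map_mul] using this
  rcases π.irreducible K hcl hinv with hK | hK
  · right
    intro j hj
    rw [IrreducibleRep.mem_kernel]
    ext v
    have : π.toHom j v ∈ K := by
      rw [memK]
      intro i hi
      have hij : i * j ∈ π.kernel :=
        h ⟨I.mul_mem_right _ _ hi, J.mul_mem_left _ _ hj⟩
      rw [IrreducibleRep.mem_kernel, map_mul] at hij
      simpa using congrArg (fun T => T v) hij
    rw [hK, Submodule.mem_bot] at this
    simpa using this
  · left
    intro i hi
    rw [IrreducibleRep.mem_kernel]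
    ext v
    have hv : v ∈ K := by rw [hK]; exact Submodule.mem_top
    simpa using (memK v).1 hv i hi

variable (A) in
/-- The primitive spectrum: the set of kernels of irreducible representations. -/
def PrimitiveSpectrum : Type u :=
  {t : TwoSidedIdeal A // ∃ π : IrreducibleRep A, π.kernel = t}

/-- The hull of an ideal: the set of primitive ideals that contain it. -/
def hull (I : TwoSidedIdeal A) : Set (PrimitiveSpectrum A) :=
  {t | I ≤ t.1}

theorem mem_hull {I : TwoSidedIdeal A} {t : PrimitiveSpectrum A} : t ∈ hull I ↔ I ≤ t.1 :=
  Iff.rfl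

theorem isClosed_primitive (t : PrimitiveSpectrum A) : IsClosed (t.1 : Set A) := by
  obtain ⟨t, π, rfl⟩ := t
  have : (π.kernel : Set A) = {a | π.toHom a = 0} := by
    ext a
    exact IrreducibleRep.mem_kernel
  change IsClosed (π.kernel : Set A)
  rw [this]
  have hc : Continuous π.toHom :=
    (NonUnitalStarAlgHom.instContinuousLinearMapClassComplex (F := A →⋆ₙₐ[ℂ] (π.H →L[ℂ] π.H))
      (A := A) (B := π.H →L[ℂ] π.H)).map_continuous π.toHom
  exact isClosed_eq hc continuous_const

theorem hull_top : hull (⊤ : TwoSidedIdeal A) = ∅ := by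
  rw [Set.eq_empty_iff_forall_notMem]
  rintro ⟨t, π, rfl⟩ h
  obtain ⟨a, ha⟩ := π.nonzero
  exact ha (IrreducibleRep.mem_kernel.1 (mem_hull.1 h trivial))

theorem hull_inf (I J : TwoSidedIdeal A) : hull (I ⊓ J) = hull I ∪ hull J := by
  ext t
  rw [Set.mem_union, mem_hull, mem_hull, mem_hull]
  constructor
  · obtain ⟨t, π, rfl⟩ := t
    exact π.kernel_prime
  · rintro (h | h)
    · exact le_trans inf_le_left h
    · exact le_trans inf_le_right h

/-- The Jacobson topology: the closed sets are exactly the hulls of the closed ideals. -/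
instance : TopologicalSpace (PrimitiveSpectrum A) :=
  TopologicalSpace.ofClosed {C | ∃ I : TwoSidedIdeal A, IsClosed (I : Set A) ∧ C = hull I}
    ⟨⊤, by
      have : ((⊤ : TwoSidedIdeal A) : Set A) = Set.univ := Set.eq_univ_of_forall fun _ => trivial
      rw [this]
      exact isClosed_univ, hull_top.symm⟩
    (by
      intro S hS
      refine ⟨sInf (Subtype.val '' ⋂₀ S), ?_, ?_⟩
      · have : ((sInf (Subtype.val '' ⋂₀ S) : TwoSidedIdeal A) : Set A) =
            ⋂ t : PrimitiveSpectrum A, ⋂ _ : t ∈ ⋂₀ S, (t.1 : Set A) := by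
          ext a
          simp only [SetLike.mem_coe, TwoSidedIdeal.mem_sInf, Set.mem_iInter]
          constructor
          · intro h t ht
            exact h t.1 ⟨t, ht, rfl⟩
          · rintro h _ ⟨t, ht, rfl⟩
            exact h t ht
        rw [this]
        exact isClosed_biInter fun t _ => isClosed_primitive t
      · ext t
        rw [mem_hull]
        constructor
        · intro ht
          exact sInf_le ⟨t, ht, rfl⟩
        · intro ht C hC
          obtain ⟨I, hI, rfl⟩ := hS hC
          rw [mem_hull]
          refine le_trans (le_sInf ?_) ht
          rintro _ ⟨s, hs, rfl⟩
          exact mem_hull.1 (hs _ hC))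
    (by
      rintro _ ⟨I, hI, rfl⟩ _ ⟨J, hJ, rfl⟩
      exact ⟨I ⊓ J, hI.inter hJ, (hull_inf I J).symm⟩)

/-! ### The Pedersen rank -/

/-- The rank of the operator `π(a)`: the dimension of its range, `⊤` if that is infinite. -/
noncomputable def IrreducibleRep.opRank (π : IrreducibleRep A) (a : A) : ℕ∞ :=
  Cardinal.toENat (π.toHom a).toLinearMap.rank

/-- The Pedersen function `w_a : Ker ρ ↦ rank ρ(a)` of `a`. The value `rank ρ(a)` is the same for
all irreducible representations `ρ` with the given kernel; it is written here, without a choice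
of `ρ`, as the supremum over all of them. -/
noncomputable def pedersenFunction (a : A) (t : PrimitiveSpectrum A) : ℕ∞ :=
  ⨆ π : {π : IrreducibleRep A // π.kernel = t.1}, π.1.opRank a

/-- The Pedersen rank of an element: the rank of its Pedersen function. -/
noncomputable def elementRank (a : A) : WithTop Ordinal.{u} :=
  functionRank (pedersenFunction a)

variable (A) in
/-- The Pedersen rank of a C*-algebra: the supremum of the Pedersen ranks of its elements. -/
noncomputable def algebraRank : WithTop Ordinal.{u} :=
  ⨆ a : A, elementRank a

variable (A) in
/-- `A` is `α`-subhomogeneous if its Pedersen rank is at most `α`. -/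
def IsSubhomogeneous (α : Ordinal.{u}) : Prop :=
  algebraRank A ≤ (α : WithTop Ordinal.{u})

variable (A) in
/-- `A` is preliminary if it has no infinite-dimensional irreducible representation. -/
def IsPreliminary : Prop :=
  ∀ π : IrreducibleRep A, FiniteDimensional ℂ π.H

end PedersenRank

namespace PedersenRank

/-! ### Capelli sums -/

/-! Suppose `A` is preliminary. Every Pedersen function is dominated by the single function
`dimFunction`, and a smaller function has smaller orders, so it suffices to bound the orders of
`dimFunction` by one countable ordinal. The sets `O α = orderLE dimFunction α` are open and increase
with `α`; their complements correspond to an increasing family of closed ideals of `A`. Since `A` is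
separable in norm, that family is stationary at some countable `α` (`exists_succ_subset`).

If `O α` were not all of `Prim A`, its complement would be a nonempty closed set covered by the sets
`dimLE A n`. Each of these is closed: Capelli sums of suitable length vanish in dimension at most
`n` but not in larger finite dimension (`capelli_eq_zero`, `exists_capelli_ne_zero`). Closed subsets
of `Prim A` have the Baire property (`exists_forall_notMem_hull`), so dimension is bounded on a
nonempty relatively open piece of the complement. The points of that piece have order at most `α +
1`, contradicting stationarity.

Conversely, let `π` be an infinite-dimensional irreducible representation. If every `π a` had finite
rank, Baire category in `A` would bound these ranks uniformly (`exists_rank_le`), while an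
approximate unit produces arbitrarily large ranks (`exists_le_rank`). So some `π a` has infinite
rank, and the Pedersen rank of `A` is `⊤`. -/

/-- The Capelli sum `∑ sgn(σ) ∏ x i * z (σ i) * y i`, alternating in `z`. -/
def capelli {B : Type*} [Ring B] {m : ℕ} (x y z : Fin m → B) : B :=
  ∑ σ : Equiv.Perm (Fin m), Equiv.Perm.sign σ •
    (List.ofFn fun i => x i * z (σ i) * y i).prod

/-- The sum is the alternatization in `z` of a multilinear map, and alternating maps kill linearly
dependent families. -/
theorem capelli_eq_zero {B : Type*} [Ring B] [Algebra ℂ B] [FiniteDimensional ℂ B] {m : ℕ}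
    (hm : Module.finrank ℂ B < m) (x y z : Fin m → B) : capelli x y z = 0 := by
  let f : MultilinearMap ℂ (fun _ : Fin m => B) B :=
    (MultilinearMap.mkPiAlgebraFin ℂ m B).compLinearMap fun i =>
      LinearMap.mulRight ℂ (y i) ∘ₗ LinearMap.mulLeft ℂ (x i)
  have h : MultilinearMap.alternatization f z = capelli x y z := by
    simp [MultilinearMap.alternatization_apply, capelli, f]
  rw [← h]
  refine AlternatingMap.map_linearDependent _ _ fun hz => ?_
  have := hz.fintype_card_le_finrank
  simp only [Fintype.card_fin] at this
  omega

variable {A : Type u} [NonUnitalCStarAlgebra A]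

/-- Products and Capelli sums need a unit, which `A` may lack. A nonempty product of images still
comes from `A`, through one element that serves all representations at once. -/
theorem IrreducibleRep.exists_eq_list_prod (l : List A) (hl : l ≠ []) :
    ∃ c : A, ∀ π : IrreducibleRep A, π.toHom c = (l.map π.toHom).prod := by
  induction l with
  | nil => exact absurd rfl hl
  | cons a l ih =>
    rcases eq_or_ne l [] with rfl | h
    · exact ⟨a, fun π => by simp⟩
    · obtain ⟨c, hc⟩ := ih h
      exact ⟨a * c, fun π => by simp [hc]⟩

theorem IrreducibleRep.exists_eq_capelli {m : ℕ} (hm : m ≠ 0) (x y z : Fin m → A) :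
    ∃ c : A, ∀ π : IrreducibleRep A,
      π.toHom c = capelli (π.toHom ∘ x) (π.toHom ∘ y) (π.toHom ∘ z) := by
  have h : ∀ σ : Equiv.Perm (Fin m), ∃ c : A, ∀ π : IrreducibleRep A,
      π.toHom c = ((List.ofFn fun i => x i * z (σ i) * y i).map π.toHom).prod := fun σ =>
    exists_eq_list_prod _ (by simpa using hm)
  choose c hc using h
  refine ⟨∑ σ : Equiv.Perm (Fin m), ((Equiv.Perm.sign σ : ℤˣ) : ℤ) • c σ, fun π => ?_⟩
  rw [map_sum]
  refine Finset.sum_congr rfl fun σ _ => ?_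
  rw [map_zsmul, hc, Units.smul_def, List.map_ofFn]
  congr 3
  ext i : 1
  simp

/-! ### Finite-dimensional irreducible representations -/

/-- The extension of an irreducible representation to the unitization. -/
noncomputable def IrreducibleRep.unital (π : IrreducibleRep A) :
    Unitization ℂ A →⋆ₐ[ℂ] (π.H →L[ℂ] π.H) :=
  Unitization.starLift π.toHom

theorem IrreducibleRep.unital_inr (π : IrreducibleRep A) (a : A) :
    π.unital (a : Unitization ℂ A) = π.toHom a := by
  exact (Unitization.lift_symm_apply_apply (π.unital.toAlgHom) a).symm.trans
    (congrArg (fun f : A →⋆ₙₐ[ℂ] (π.H →L[ℂ] π.H) => f a)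
      (Unitization.starLift.symm_apply_apply π.toHom))

/-- Burnside's theorem for the extension to the unitization. -/
theorem IrreducibleRep.unital_surjective (π : IrreducibleRep A) [FiniteDimensional ℂ π.H]
    (T : π.H →ₗ[ℂ] π.H) : ∃ r, (π.unital r).toLinearMap = T := by
  let : Module (Unitization ℂ A) π.H :=
    Module.compHom π.H ((ContinuousLinearMap.toLinearMapRingHom
      (R₁ := ℂ) (M₁ := π.H)).comp (π.unital : Unitization ℂ A →+* (π.H →L[ℂ] π.H)))
  have hsmul : ∀ (r : Unitization ℂ A) (v : π.H), r • v = π.unital r v := fun _ _ => rfl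
  have : IsScalarTower ℂ (Unitization ℂ A) π.H :=
    ⟨fun c r v => by simp [hsmul]⟩
  have : Nontrivial π.H := by
    obtain ⟨a, ha⟩ := π.nonzero
    by_contra h
    rw [not_nontrivial_iff_subsingleton] at h
    exact ha (ContinuousLinearMap.ext fun v => Subsingleton.elim _ _)
  have : IsSimpleModule (Unitization ℂ A) π.H := by
    rw [isSimpleModule_iff]
    refine { eq_bot_or_eq_top := fun K => ?_ }
    rcases π.irreducible (K.restrictScalars ℂ) (Submodule.closed_of_finiteDimensional _)
      fun a v hv => by
        rw [← π.unital_inr a]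
        exact K.smul_mem (a : Unitization ℂ A) hv with h | h
    · left
      exact (Submodule.restrictScalars_eq_bot_iff _ _ _).1 h
    · right
      exact (Submodule.restrictScalars_eq_top_iff _ _ _).1 h
  have hschur := (IsSimpleModule.algebraMap_end_bijective_of_isAlgClosed
    (A := Unitization ℂ A) (V := π.H) ℂ).2
  -- By Schur's lemma the commutant is `ℂ`, so any linear `T` commutes with it and the density
  -- theorem applies.
  let f : Module.End (Module.End (Unitization ℂ A) π.H) π.H :=
    { toFun := T
      map_add' := map_add T
      map_smul' := fun g v => by
        obtain ⟨c, rfl⟩ := hschur g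
        simp }
  classical
  obtain ⟨r, hr⟩ := jacobson_density f
    (Finset.univ.image (Module.finBasis ℂ π.H))
  refine ⟨r, (Module.finBasis ℂ π.H).ext fun i => ?_⟩
  exact (hr _ (Finset.mem_image_of_mem _ (Finset.mem_univ i))).symm

/-- Burnside's theorem is available only over the unitization. Sandwiching some `a` with `π a ≠ 0`
between two rank-one elements `s` and `t` gives a product that lies in `A`, since `A` is an ideal
there. -/
theorem IrreducibleRep.exists_rankOne (π : IrreducibleRep A) [FiniteDimensional ℂ π.H]
    (φ : π.H →ₗ[ℂ] ℂ) (w : π.H) : ∃ a, ∀ v, π.toHom a v = φ v • w := by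
  obtain ⟨a, ha⟩ := π.nonzero
  obtain ⟨u, hu⟩ : ∃ u, π.toHom a u ≠ 0 := by
    by_contra! h
    exact ha (ContinuousLinearMap.ext h)
  obtain ⟨ψ, hψ⟩ := Module.Projective.exists_dual_ne_zero ℂ hu
  obtain ⟨s, hs⟩ := π.unital_surjective (((ψ (π.toHom a u))⁻¹ • ψ).smulRight w)
  obtain ⟨t, ht⟩ := π.unital_surjective (φ.smulRight u)
  have hst : s * (a : Unitization ℂ A) * t =
      (((s * (a : Unitization ℂ A) * t).snd : A) : Unitization ℂ A) := by
    apply Unitization.ext <;> simp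
  refine ⟨(s * (a : Unitization ℂ A) * t).snd, fun v => ?_⟩
  have hs' : ∀ v, π.unital s v = ((ψ (π.toHom a u))⁻¹ * ψ v) • w := fun v => by
    simpa using congrArg (fun S => S v) hs
  have ht' : ∀ v, π.unital t v = φ v • u := fun v => by
    simpa using congrArg (fun S => S v) ht
  rw [← π.unital_inr, ← hst, map_mul, map_mul, π.unital_inr]
  simp only [mul_apply_eq_comp, ht', map_smul, hs', inv_mul_cancel₀ hψ, one_smul]

/-- With matrix units the Capelli sum collapses to the single diagonal unit `e o o`. -/
theorem IrreducibleRep.exists_capelli_ne_zero (π : IrreducibleRep A) [FiniteDimensional ℂ π.H] :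
    ∃ x y z : Fin (Module.finrank ℂ π.H * Module.finrank ℂ π.H) → A,
      capelli (π.toHom ∘ x) (π.toHom ∘ y) (π.toHom ∘ z) ≠ 0 := by
  set d := Module.finrank ℂ π.H with hd
  let b := Module.finBasis ℂ π.H
  have h : ∀ i j : Fin d, ∃ a, ∀ v, π.toHom a v = b.coord j v • b i := fun i j =>
    π.exists_rankOne (b.coord j) (b i)
  choose e he using h
  have : Nontrivial π.H := by
    obtain ⟨a, ha⟩ := π.nonzero
    by_contra h
    rw [not_nontrivial_iff_subsingleton] at h
    exact ha (ContinuousLinearMap.ext fun v => Subsingleton.elim _ _)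
  have hd0 : 0 < d := Module.finrank_pos
  let o : Fin d := ⟨0, hd0⟩
  let q : Fin (d * d) ≃ Fin d × Fin d := finProdFinEquiv.symm
  -- The outer units isolate one matrix entry: the factor at position `i` is `e o o` if `σ i = i`,
  -- and `0` otherwise. So only the identity permutation contributes.
  refine ⟨fun i => e o (q i).1, fun i => e (q i).2 o, fun i => e (q i).1 (q i).2, ?_⟩
  have hunit : ∀ i j, π.toHom (e o (q i).1) * π.toHom (e (q j).1 (q j).2) *
      π.toHom (e (q i).2 o) = if j = i then π.toHom (e o o) else 0 := by
    intro i j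
    ext v
    split_ifs with hij
    · subst hij
      simp [he]
    · have : ¬ ((q j).1 = (q i).1 ∧ (q j).2 = (q i).2) := fun h' =>
        hij (q.injective (Prod.ext h'.1 h'.2))
      by_cases h1 : (q j).1 = (q i).1
      · have h2 : (q j).2 ≠ (q i).2 := fun h2 => this ⟨h1, h2⟩
        simp [he, h2.symm]
      · have h3 : b.repr (b (q j).1) (q i).1 = 0 := by
          rw [b.repr_self, Finsupp.single_apply, if_neg h1]
        have h4 : b.coord (q i).1 (b (q j).1) = 0 := h3
        simp only [mul_apply_eq_comp, _root_.zero_apply, he, map_smul, h4, smul_zero,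
          zero_smul]
  have hidem : IsIdempotentElem (π.toHom (e o o)) := by
    ext v
    simp [he]
  have hcap : capelli (π.toHom ∘ fun i => e o (q i).1) (π.toHom ∘ fun i => e (q i).2 o)
      (π.toHom ∘ fun i => e (q i).1 (q i).2) = π.toHom (e o o) := by
    rw [capelli, Finset.sum_eq_single 1]
    · simp only [Function.comp_apply, hunit, Equiv.Perm.coe_one, id, if_true,
        Equiv.Perm.sign_one, one_smul, List.ofFn_const, List.prod_replicate]
      exact hidem.pow_eq (by positivity)
    · intro σ _ hσ
      obtain ⟨i, hi⟩ : ∃ i, σ i ≠ i := by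
        by_contra! hcon
        exact hσ (Equiv.ext hcon)
      rw [List.prod_eq_zero, smul_zero]
      rw [List.mem_ofFn]
      exact ⟨i, by simp only [Function.comp_apply, hunit, if_neg hi]⟩
    · simp
  rw [hcap]
  intro h0
  have := congrArg (fun S => S (b o)) h0
  simp only [he] at this
  simp [b.ne_zero] at this

/-- The primitive ideals that are kernels of representations of dimension at most `n`. -/
def dimLE (A : Type u) [NonUnitalCStarAlgebra A] (n : ℕ) : Set (PrimitiveSpectrum A) :=
  {t | ∃ π : IrreducibleRep A, π.kernel = t.1 ∧ FiniteDimensional ℂ π.H ∧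
    Module.finrank ℂ π.H ≤ n}

theorem finrank_clm (H : Type*) [NormedAddCommGroup H] [InnerProductSpace ℂ H]
    [FiniteDimensional ℂ H] :
    Module.finrank ℂ (H →L[ℂ] H) = Module.finrank ℂ H * Module.finrank ℂ H := by
  rw [← (LinearMap.toContinuousLinearMap (𝕜 := ℂ) (E := H) (F' := H)).finrank_eq,
    Module.finrank_linearMap]

/-- If the dimension `d` of `π` exceeded `n`, a Capelli sum of length `d * d` would be nonzero in
`π` but zero in all representations of dimension at most `n`, since `n * n < d * d`. This is what
makes `dimLE A n` closed when `A` is preliminary. -/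
theorem IrreducibleRep.finrank_le_of_sInf_dimLE_le (π : IrreducibleRep A)
    [FiniteDimensional ℂ π.H] {n : ℕ} (h : sInf (Subtype.val '' dimLE A n) ≤ π.kernel) :
    Module.finrank ℂ π.H ≤ n := by
  by_contra! hn
  obtain ⟨x, y, z, hne⟩ := π.exists_capelli_ne_zero
  obtain ⟨c, hc⟩ := exists_eq_capelli (Nat.mul_pos (by omega) (by omega)).ne' x y z
  rw [← hc] at hne
  refine hne (IrreducibleRep.mem_kernel.1 (h ?_))
  rw [TwoSidedIdeal.mem_sInf]
  rintro _ ⟨t, ⟨ρ, hρ, hfd, hle⟩, rfl⟩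
  rw [← hρ, IrreducibleRep.mem_kernel, hc]
  have : FiniteDimensional ℂ (ρ.H →L[ℂ] ρ.H) :=
    (LinearMap.toContinuousLinearMap (𝕜 := ℂ) (E := ρ.H) (F' := ρ.H)).finiteDimensional
  refine capelli_eq_zero ?_ _ _ _
  rw [finrank_clm]
  exact Nat.mul_lt_mul'' (by omega) (by omega)

/-! ### Pure states -/

section States

open scoped ComplexOrder InnerProductSpace

variable {B : Type u} [CStarAlgebra B]

/-- A state of a unital C*-algebra, as a bare function. -/
structure IsState (f : B → ℂ) : Prop where
  map_add : ∀ x y, f (x + y) = f x + f y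
  map_smul : ∀ (c : ℂ) x, f (c • x) = c * f x
  map_one : f 1 = 1
  nonneg : ∀ x, 0 ≤ f (star x * x)
  norm_le : ∀ x, ‖f x‖ ≤ ‖x‖

/-- The vector state given by a vector of norm one. -/
theorem isState_inner {H : Type*} [NormedAddCommGroup H] [InnerProductSpace ℂ H] [CompleteSpace H]
    (σ : B →⋆ₐ[ℂ] (H →L[ℂ] H)) {ξ : H} (hξ : ‖ξ‖ = 1) :
    IsState fun x => ⟪ξ, σ x ξ⟫_ℂ where
  map_add x y := by simp
  map_smul c x := by simp
  map_one := by simp [inner_self_eq_norm_sq_to_K, hξ]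
  nonneg x := by
    have : ⟪ξ, σ (star x * x) ξ⟫_ℂ = ⟪σ x ξ, σ x ξ⟫_ℂ := by
      rw [_root_.map_mul, map_star, ContinuousLinearMap.star_eq_adjoint, mul_apply_eq_comp,
        ContinuousLinearMap.adjoint_inner_right]
    rw [this, inner_self_eq_norm_sq_to_K, RCLike.ofReal_eq_complex_ofReal]
    exact_mod_cast sq_nonneg ‖σ x ξ‖
  norm_le x := by
    calc ‖⟪ξ, σ x ξ⟫_ℂ‖ ≤ ‖ξ‖ * ‖σ x ξ‖ := norm_inner_le_norm _ _
      _ ≤ ‖ξ‖ * (‖σ x‖ * ‖ξ‖) := by gcongr; exact (σ x).le_opNorm ξ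
      _ = ‖σ x‖ := by rw [hξ]; ring
      _ ≤ ‖x‖ := NonUnitalStarAlgHom.norm_apply_le σ x

/-- The GNS representation of a state, with its cyclic vector. -/
theorem IsState.exists_gns {f : B → ℂ} (hf : IsState f) :
    ∃ (H : Type u) (_ : NormedAddCommGroup H) (_ : InnerProductSpace ℂ H) (_ : CompleteSpace H)
      (σ : B →⋆ₐ[ℂ] (H →L[ℂ] H)) (ξ : H), (∀ x, f x = ⟪ξ, σ x ξ⟫_ℂ) ∧
        DenseRange fun x => σ x ξ := by
  let _ : PartialOrder B := CStarAlgebra.spectralOrder B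
  have _ : StarOrderedRing B := CStarAlgebra.spectralOrderedRing B
  let L : B →ₗ[ℂ] ℂ :=
    { toFun := f
      map_add' := hf.map_add
      map_smul' := hf.map_smul }
  let F : B →ₚ[ℂ] ℂ := PositiveLinearMap.mk₀ L fun x hx => by
    obtain ⟨y, rfl⟩ := CStarAlgebra.nonneg_iff_eq_star_mul_self.1 hx
    exact hf.nonneg y
  have hF : ∀ x, F x = f x := fun _ => rfl
  have horb : ∀ x, F.gnsStarAlgHom x ((F.toPreGNS 1 : F.PreGNS) : F.GNS) =
      ((F.toPreGNS x : F.PreGNS) : F.GNS) := fun x => by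
    refine (F.gnsNonUnitalStarAlgHom_apply_coe (a := x) (b := F.toPreGNS 1)).trans ?_
    simp
  refine ⟨F.GNS, inferInstance, inferInstance, inferInstance, F.gnsStarAlgHom,
    ((F.toPreGNS 1 : F.PreGNS) : F.GNS), fun x => ?_, ?_⟩
  · rw [horb, UniformSpace.Completion.inner_coe, PositiveLinearMap.preGNS_inner_def]
    simp [hF]
  · have : (fun x => F.gnsStarAlgHom x ((F.toPreGNS 1 : F.PreGNS) : F.GNS)) =
        (fun y : F.PreGNS => (y : F.GNS)) ∘ F.toPreGNS := funext horb
    rw [this]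
    exact UniformSpace.Completion.denseRange_coe.comp F.toPreGNS.surjective.denseRange
      (UniformSpace.Completion.continuous_coe _)

/-- The states that vanish on `N` and take the value one at the `e i`. -/
def stateFace {ι : Type*} (N : Set B) (e : ι → B) : Set (B → ℂ) :=
  {f | IsState f ∧ (∀ x ∈ N, f x = 0) ∧ ∀ i, f (e i) = 1}

theorem isClosed_stateFace {ι : Type*} (N : Set B) (e : ι → B) : IsClosed (stateFace N e) := by
  have : stateFace N e =
      (⋂ x, ⋂ y, {f | f (x + y) = f x + f y}) ∩ (⋂ c : ℂ, ⋂ x, {f | f (c • x) = c * f x}) ∩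
      {f | f 1 = 1} ∩ (⋂ x, {f | 0 ≤ f (star x * x)}) ∩ (⋂ x, {f | ‖f x‖ ≤ ‖x‖}) ∩
      (⋂ x ∈ N, {f | f x = 0}) ∩ ⋂ i, {f | f (e i) = 1} := by
    ext f
    simp only [Set.mem_inter_iff, Set.mem_iInter, Set.mem_ofPred_eq]
    constructor
    · rintro ⟨⟨h1, h2, h3, h4, h5⟩, h6, h7⟩
      exact ⟨⟨⟨⟨⟨⟨h1, h2⟩, h3⟩, h4⟩, h5⟩, h6⟩, h7⟩
    · rintro ⟨⟨⟨⟨⟨⟨h1, h2⟩, h3⟩, h4⟩, h5⟩, h6⟩, h7⟩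
      exact ⟨⟨h1, h2, h3, h4, h5⟩, h6, h7⟩
  rw [this]
  refine ((((((isClosed_iInter fun x => isClosed_iInter fun y => ?_).inter
    (isClosed_iInter fun c => isClosed_iInter fun x => ?_)).inter ?_).inter
    (isClosed_iInter fun x => ?_)).inter (isClosed_iInter fun x => ?_)).inter
    (isClosed_iInter fun x => isClosed_iInter fun _ => ?_)).inter (isClosed_iInter fun i => ?_)
  · exact isClosed_eq (by fun_prop) (by fun_prop)
  · exact isClosed_eq (by fun_prop) (by fun_prop)
  · exact isClosed_eq (by fun_prop) (by fun_prop)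
  · exact isClosed_le (by fun_prop) (by fun_prop)
  · exact isClosed_le (by fun_prop) (by fun_prop)
  · exact isClosed_eq (by fun_prop) (by fun_prop)
  · exact isClosed_eq (by fun_prop) (by fun_prop)

/-- Tychonoff: the norm bound places the states in a product of discs, with the topology of
pointwise convergence. -/
theorem isCompact_stateFace {ι : Type*} (N : Set B) (e : ι → B) : IsCompact (stateFace N e) := by
  refine (isCompact_univ_pi fun x : B => isCompact_closedBall (0 : ℂ) ‖x‖).of_isClosed_subset
    (isClosed_stateFace N e) fun f hf x _ => ?_
  rw [mem_closedBall_zero_iff]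
  exact hf.1.norm_le x

/-- The GNS representation of an extreme point of `stateFace N e` is irreducible. -/
theorem irreducible_of_mem_extremePoints {ι : Type*} {N : Set B}
    (hN : ∀ x ∈ N, ∀ a b, a * x * b ∈ N) {e : ι → B} (he : ∀ i, ‖e i‖ ≤ 1) {f : B → ℂ}
    (hf : f ∈ (stateFace N e).extremePoints ℝ)
    {H : Type*} [NormedAddCommGroup H] [InnerProductSpace ℂ H] [CompleteSpace H]
    (σ : B →⋆ₐ[ℂ] (H →L[ℂ] H)) (ξ : H) (hσ : ∀ x, f x = ⟪ξ, σ x ξ⟫_ℂ)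
    (hd : DenseRange fun x => σ x ξ) :
    (∀ x ∈ N, σ x = 0) ∧ ∀ K : Submodule ℂ H, IsClosed (K : Set H) →
      (∀ x, ∀ v ∈ K, σ x v ∈ K) → K = ⊥ ∨ K = ⊤ := by
  obtain ⟨⟨hst, hf0, hf1⟩, hext⟩ := hf
  have hzero : ∀ v : H, (∀ x, ⟪v, σ x ξ⟫_ℂ = 0) → v = 0 := fun v hv => by
    have : (fun w => ⟪v, w⟫_ℂ) = fun _ => 0 :=
      hd.equalizer (by fun_prop) continuous_const (funext hv)
    exact inner_self_eq_zero.1 (congrFun this v)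
  have hadj : ∀ x v w, ⟪σ x v, w⟫_ℂ = ⟪v, σ (star x) w⟫_ℂ := fun x v w => by
    rw [map_star, ContinuousLinearMap.star_eq_adjoint, ContinuousLinearMap.adjoint_inner_right]
  have hker : ∀ x ∈ N, σ x = 0 := by
    intro x hx
    have h1 : ∀ b, σ x (σ b ξ) = 0 := fun b => by
      refine hzero _ fun a => ?_
      have h2 : ⟪σ a ξ, σ x (σ b ξ)⟫_ℂ = 0 := by
        rw [hadj, ← mul_apply_eq_comp, ← mul_apply_eq_comp, ← _root_.map_mul, ← _root_.map_mul,
          ← hσ]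
        exact hf0 _ (hN x hx _ _)
      rw [← inner_conj_symm, h2, _root_.map_zero]
    have : (fun v => σ x v) = fun _ => 0 :=
      hd.equalizer (σ x).continuous continuous_const (funext h1)
    exact ContinuousLinearMap.ext fun v => congrFun this v
  have hξ : ‖ξ‖ = 1 := by
    have h1 := hσ 1
    rw [hst.map_one, _root_.map_one, one_apply_eq_self, inner_self_eq_norm_sq_to_K,
      RCLike.ofReal_eq_complex_ofReal] at h1
    have h2 : ‖ξ‖ ^ 2 = 1 := by exact_mod_cast h1.symm
    exact (pow_eq_one_iff_of_nonneg (norm_nonneg ξ) two_ne_zero).1 h2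
  have htop : ∀ L : Submodule ℂ H, IsClosed (L : Set H) → (∀ x, ∀ v ∈ L, σ x v ∈ L) → ξ ∈ L →
      L = ⊤ := fun L hL hinv hmem => by
    rw [eq_top_iff]
    intro v _
    have : Set.range (fun x => σ x ξ) ⊆ L := by
      rintro _ ⟨x, rfl⟩
      exact hinv x ξ hmem
    exact closure_minimal this hL (hd v)
  refine ⟨hker, fun K hK hinv => ?_⟩
  have : CompleteSpace K := hK.completeSpace_coe
  have hinv' : ∀ x, ∀ v ∈ Kᗮ, σ x v ∈ Kᗮ := fun x v hv => by
    rw [Submodule.mem_orthogonal] at hv ⊢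
    intro w hw
    have := hv _ (hinv (star x) w hw)
    rwa [hadj, star_star] at this
  -- If both components of `ξ` along `K` and `Kᗮ` are nonzero, their normalized vector states
  -- express `f` as a proper convex combination.
  obtain ⟨η, hη, ζ, hζ, hsum⟩ := K.exists_add_mem_mem_orthogonal ξ
  by_cases hη0 : η = 0
  · left
    rw [hη0, zero_add] at hsum
    have := htop Kᗮ K.isClosed_orthogonal hinv' (hsum ▸ hζ)
    rwa [Submodule.orthogonal_eq_top_iff] at this
  by_cases hζ0 : ζ = 0
  · right
    rw [hζ0, add_zero] at hsum
    exact htop K hK hinv (hsum ▸ hη)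
  right
  have hηpos : 0 < ‖η‖ := norm_pos_iff.2 hη0
  have hζpos : 0 < ‖ζ‖ := norm_pos_iff.2 hζ0
  have hcross : ∀ x, ⟪η, σ x ζ⟫_ℂ = 0 := fun x =>
    (Submodule.mem_orthogonal _ _).1 (hinv' x ζ hζ) η hη
  have hcross' : ∀ x, ⟪ζ, σ x η⟫_ℂ = 0 := fun x =>
    (Submodule.mem_orthogonal' _ _).1 hζ _ (hinv x η hη)
  have hpyth : ‖η‖ ^ 2 + ‖ζ‖ ^ 2 = 1 := by
    have h1 := norm_add_sq_eq_norm_sq_add_norm_sq_of_inner_eq_zero η ζ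
      ((Submodule.mem_orthogonal _ _).1 hζ η hη)
    rw [← hsum, hξ] at h1
    linarith
  have hunit : ∀ v : H, v ≠ 0 → ‖((‖v‖⁻¹ : ℝ) : ℂ) • v‖ = 1 := fun v hv => by
    rw [norm_smul, Complex.norm_real, norm_inv, norm_norm, inv_mul_cancel₀ (norm_ne_zero_iff.2 hv)]
  let g : H → B → ℂ := fun v x => ⟪((‖v‖⁻¹ : ℝ) : ℂ) • v, σ x (((‖v‖⁻¹ : ℝ) : ℂ) • v)⟫_ℂ
  have hg : ∀ v : H, v ≠ 0 → ∀ x, ((‖v‖ ^ 2 : ℝ) : ℂ) * g v x = ⟪v, σ x v⟫_ℂ := fun v hv x => by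
    have : (‖v‖ : ℂ) ≠ 0 := by exact_mod_cast norm_ne_zero_iff.2 hv
    simp only [g, map_smul, inner_smul_left, inner_smul_right, Complex.conj_ofReal]
    push_cast
    field_simp
  have hgst : ∀ v : H, v ≠ 0 → IsState (g v) := fun v hv => isState_inner σ (hunit v hv)
  have hdecomp : ∀ x, f x = ((‖η‖ ^ 2 : ℝ) : ℂ) * g η x + ((‖ζ‖ ^ 2 : ℝ) : ℂ) * g ζ x := fun x => by
    rw [hg η hη0, hg ζ hζ0, hσ, hsum, map_add, inner_add_left, inner_add_right, inner_add_right,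
      hcross, hcross']
    ring
  have hone : ∀ i, g η (e i) = 1 ∧ g ζ (e i) = 1 := by
    intro i
    have h1 : ‖g η (e i)‖ ≤ 1 := ((hgst η hη0).norm_le _).trans (he i)
    have h2 : ‖g ζ (e i)‖ ≤ 1 := ((hgst ζ hζ0).norm_le _).trans (he i)
    have h3 : (1 : ℝ) = ‖η‖ ^ 2 * (g η (e i)).re + ‖ζ‖ ^ 2 * (g ζ (e i)).re := by
      have := congrArg Complex.re (hdecomp (e i))
      rwa [hf1, Complex.add_re, Complex.re_ofReal_mul, Complex.re_ofReal_mul, Complex.one_re] at this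
    have h1' := (Complex.re_le_norm (g η (e i))).trans h1
    have h2' := (Complex.re_le_norm (g ζ (e i))).trans h2
    -- `1` is an extreme point of the unit disc, so both vector states take the value `1` at each `e
    -- i` and remain in the face.
    have key : ∀ z : ℂ, ‖z‖ ≤ 1 → 1 ≤ z.re → z = 1 := fun z hz hre => by
      have h4 : z.re * z.re + z.im * z.im ≤ 1 := by
        rw [← Complex.normSq_apply, Complex.normSq_eq_norm_sq]
        exact pow_le_one₀ (norm_nonneg z) hz
      have h5 : z.re = 1 := le_antisymm ((Complex.re_le_norm z).trans hz) hre
      have h6 : z.im = 0 := by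
        rw [h5] at h4
        nlinarith [mul_self_nonneg z.im]
      exact Complex.ext h5 h6
    have hη2 : 0 < ‖η‖ ^ 2 := by positivity
    have hζ2 : 0 < ‖ζ‖ ^ 2 := by positivity
    exact ⟨key _ h1 (by nlinarith), key _ h2 (by nlinarith)⟩
  have hgN : ∀ v, ∀ x ∈ N, g v x = 0 := fun v x hx => by simp [g, hker x hx]
  have heq : g η = f :=
    hext ⟨hgst η hη0, hgN η, fun i => (hone i).1⟩ ⟨hgst ζ hζ0, hgN ζ, fun i => (hone i).2⟩
      ⟨‖η‖ ^ 2, ‖ζ‖ ^ 2, by positivity, by positivity, hpyth, funext fun x => by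
        simp [hdecomp x]⟩
  -- Extremality gives `g η = f`. Tested against the dense orbit of `ξ`, this makes `η` a multiple
  -- of `ξ`, so `ξ` lies in `K`.
  have hlin : η - ((‖η‖ ^ 2 : ℝ) : ℂ) • ξ = 0 := by
    refine hzero _ fun x => ?_
    have h1 : ⟪η, σ x ξ⟫_ℂ = ⟪η, σ x η⟫_ℂ := by
      rw [hsum, map_add, inner_add_right, hcross, add_zero]
    rw [inner_sub_left, inner_smul_left, Complex.conj_ofReal, h1, ← hσ, ← hg η hη0, heq, sub_self]
  refine htop K hK hinv ?_
  have hne : ((‖η‖ ^ 2 : ℝ) : ℂ) ≠ 0 := by exact_mod_cast (pow_pos hηpos 2).ne'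
  have : ξ = (((‖η‖ ^ 2 : ℝ) : ℂ)⁻¹) • η := by
    rw [sub_eq_zero.1 hlin, smul_smul, ← sub_eq_zero.1 hlin, inv_mul_cancel₀ hne, one_smul]
  rw [this]
  exact K.smul_mem _ hη

end States

/-! ### The Baire property of the primitive spectrum -/

/-- The vectors killed by all `π (p * x)` form a closed invariant subspace. If `p A j` lay in the
kernel, it would contain the range of `π j`; being trivial it would then force `π j = 0` or `π (p *
star p) = 0`. -/
theorem IrreducibleRep.exists_mul_mul_notMem (π : IrreducibleRep A) {p j : A}
    (hp : p ∉ π.kernel) (hj : j ∉ π.kernel) : ∃ x, p * x * j ∉ π.kernel := by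
  by_contra! hcon
  simp only [IrreducibleRep.mem_kernel, map_mul] at hp hj hcon
  let K : Submodule ℂ π.H := ⨅ x : A, LinearMap.ker (π.toHom p * π.toHom x).toLinearMap
  have memK : ∀ w, w ∈ K ↔ ∀ x, π.toHom p (π.toHom x w) = 0 := fun w => by
    simp [K, Submodule.mem_iInf]
  have hcl : IsClosed (K : Set π.H) := by
    have : (K : Set π.H) = ⋂ x : A, {w | (π.toHom p * π.toHom x) w = 0} := by
      ext w
      simp [memK]
    rw [this]
    exact isClosed_iInter fun x =>
      isClosed_eq (π.toHom p * π.toHom x).continuous continuous_const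
  have hinv : ∀ a, ∀ w ∈ K, π.toHom a w ∈ K := fun a w hw => by
    rw [memK] at hw ⊢
    intro x
    have := hw (x * a)
    rwa [map_mul, mul_apply_eq_comp] at this
  obtain ⟨v, hv⟩ : ∃ v, π.toHom j v ≠ 0 := by
    by_contra! h
    exact hj (ContinuousLinearMap.ext h)
  rcases π.irreducible K hcl hinv with h | h
  · refine hv ((Submodule.mem_bot ℂ).1 (h ▸ (memK _).2 fun x => ?_))
    exact congrArg (fun T => T v) (hcon x)
  · refine hp ?_
    rw [← CStarRing.mul_star_self_eq_zero_iff, ← map_star]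
    exact ContinuousLinearMap.ext fun w => (memK w).1 (h ▸ Submodule.mem_top) (star p)

theorem mul_star_self_notMem (t : PrimitiveSpectrum A) {c : A} (hc : c ∉ t.1) :
    c * star c ∉ t.1 := by
  obtain ⟨t, π, rfl⟩ := t
  rw [IrreducibleRep.mem_kernel] at hc ⊢
  rwa [map_mul, map_star, CStarRing.mul_star_self_eq_zero_iff]

/-- Soft thresholding: a self-adjoint element is close to one that has a local unit. -/
theorem exists_local_unit_near {b : A} (hb : IsSelfAdjoint b) {ε : ℝ} (hε : 0 < ε) :
    ∃ e h p, e = b * h ∧ ‖e‖ ≤ 1 ∧ e * p = p ∧ ‖b - p‖ ≤ ε := by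
  let f : ℝ → ℝ := fun s => min 1 (max 0 (2 * |s| / ε - 1))
  -- A continuous form of `f s / s`: the maximum alters the denominator only for `|s| < ε / 2`,
  -- where `f` vanishes. The factorization `e = b * h` keeps `e` in every ideal containing `b`.
  let h : ℝ → ℝ := fun s => f s * s / max (s ^ 2) (ε ^ 2 / 4)
  let g : ℝ → ℝ := fun s => s - max (-ε) (min s ε)
  have hden : ∀ s : ℝ, max (s ^ 2) (ε ^ 2 / 4) ≠ 0 := fun s =>
    (lt_max_of_lt_right (by positivity)).ne'
  have hf : Continuous f := by fun_prop
  have hh : Continuous h := by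
    refine Continuous.div (by fun_prop) (by fun_prop) hden
  have hg : Continuous g := by fun_prop
  have hf0 : f 0 = 0 := by simp [f]
  have hh0 : h 0 = 0 := by simp [h]
  have hg0 : g 0 = 0 := by simp [g, hε.le]
  have hfh : ∀ s, f s = s * h s := fun s => by
    rcases le_total |s| (ε / 2) with hs | hs
    · have : f s = 0 := by
        have : 2 * |s| / ε - 1 ≤ 0 := by
          rw [sub_nonpos, div_le_one hε]
          linarith
        simp [f, this]
      simp [h, this]
    · have h1 : max (s ^ 2) (ε ^ 2 / 4) = s ^ 2 := by
        refine max_eq_left ?_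
        rw [← sq_abs s]
        nlinarith
      have hs0 : s ≠ 0 := by
        rintro rfl
        rw [abs_zero] at hs
        linarith
      simp only [h, h1]
      field_simp
  have hfg : ∀ s, f s * g s = g s := fun s => by
    rcases le_total |s| ε with hs | hs
    · have : g s = 0 := by
        obtain ⟨h1, h2⟩ := abs_le.1 hs
        simp [g, h1, h2]
      rw [this, mul_zero]
    · have : f s = 1 := by
        have : 1 ≤ 2 * |s| / ε - 1 := by
          rw [le_sub_iff_add_le, le_div_iff₀ hε]
          linarith
        simp only [f]
        rw [min_eq_left]
        exact le_max_of_le_right this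
      rw [this, one_mul]
  refine ⟨cfcₙ f b, cfcₙ h b, cfcₙ g b, ?_, ?_, ?_, ?_⟩
  · conv_rhs => enter [1]; rw [← cfcₙ_id' ℝ b hb]
    rw [← cfcₙ_mul (fun s => s) h b (by fun_prop) rfl hh.continuousOn hh0]
    exact congrArg (cfcₙ · b) (funext hfh)
  · refine norm_cfcₙ_le fun s _ => ?_
    rw [Real.norm_eq_abs, abs_le]
    exact ⟨by linarith [show 0 ≤ f s from le_min zero_le_one (le_max_left _ _)], min_le_left _ _⟩
  · rw [← cfcₙ_mul f g b hf.continuousOn hf0 hg.continuousOn hg0]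
    exact congrArg (cfcₙ · b) (funext hfg)
  · conv_lhs => enter [1, 1]; rw [← cfcₙ_id' ℝ b hb]
    rw [← cfcₙ_sub (fun s => s) g b (by fun_prop) rfl hg.continuousOn hg0]
    refine norm_cfcₙ_le fun s _ => ?_
    simp only [g, sub_sub_cancel]
    rw [Real.norm_eq_abs, abs_le]
    exact ⟨le_max_left _ _, max_le (by linarith) (min_le_right _ _)⟩

/-- A self-adjoint element outside of `t` has a local unit for an element outside of `t`. -/
theorem exists_local_unit (t : PrimitiveSpectrum A) {b : A} (hb : IsSelfAdjoint b)
    (hbt : b ∉ t.1) : ∃ e h p, e = b * h ∧ ‖e‖ ≤ 1 ∧ e * p = p ∧ p ∉ t.1 := by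
  obtain ⟨ε, hε, hball⟩ := Metric.isOpen_iff.1 (isClosed_primitive t).isOpen_compl b hbt
  obtain ⟨e, h, p, heh, hnorm, hep, hbp⟩ := exists_local_unit_near hb (half_pos hε)
  refine ⟨e, h, p, heh, hnorm, hep, hball ?_⟩
  rw [Metric.mem_ball, dist_comm, dist_eq_norm]
  linarith

/-- The intersection of a set of primitive ideals. -/
def idealOf (S : Set (PrimitiveSpectrum A)) : TwoSidedIdeal A :=
  sInf (Subtype.val '' S)

theorem mem_idealOf {S : Set (PrimitiveSpectrum A)} {a : A} :
    a ∈ idealOf S ↔ ∀ t ∈ S, a ∈ t.1 := by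
  rw [idealOf, TwoSidedIdeal.mem_sInf]
  constructor
  · exact fun h t ht => h t.1 ⟨t, ht, rfl⟩
  · rintro h _ ⟨t, ht, rfl⟩
    exact h t ht

theorem isClosed_idealOf (S : Set (PrimitiveSpectrum A)) : IsClosed (idealOf S : Set A) := by
  have : (idealOf S : Set A) = ⋂ t ∈ S, (t.1 : Set A) := by
    ext a
    simp only [SetLike.mem_coe, mem_idealOf, Set.mem_iInter]
  rw [this]
  exact isClosed_biInter fun t _ => isClosed_primitive t

theorem subset_hull_idealOf (S : Set (PrimitiveSpectrum A)) : S ⊆ hull (idealOf S) :=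
  fun t ht _ ha => mem_idealOf.1 ha t ht

theorem isOpen_compl_hull {I : TwoSidedIdeal A} (hI : IsClosed (I : Set A)) :
    IsOpen (hull I)ᶜ :=
  ⟨I, hI, compl_compl _⟩

theorem hull_idealOf {S : Set (PrimitiveSpectrum A)} (hS : IsOpen Sᶜ) : hull (idealOf S) = S := by
  refine Set.Subset.antisymm ?_ (subset_hull_idealOf S)
  obtain ⟨I, -, hI⟩ := hS
  rw [compl_compl] at hI
  subst hI
  exact fun t ht a ha => ht (mem_idealOf.2 fun s hs => hs ha)

theorem isOpen_notMem (p : A) : IsOpen {t : PrimitiveSpectrum A | p ∉ t.1} := by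
  have : {t : PrimitiveSpectrum A | p ∉ t.1} = (hull (idealOf {t | p ∈ t.1}))ᶜ := by
    ext t
    rw [Set.mem_compl_iff, Set.mem_ofPred_eq, not_iff_not]
    exact ⟨fun h => subset_hull_idealOf _ h, fun h => h (mem_idealOf.2 fun _ hs => hs)⟩
  rw [this]
  exact isOpen_compl_hull (isClosed_idealOf _)

/-- A Baire argument in which nested neighbourhoods are replaced by contractions `e n ∈ J n` with `e
n * e (n + 1) = e (n + 1)`. Compactness yields a state equal to `1` at every `e n`; an extreme such
state gives an irreducible representation whose kernel contains `I` but no `e n`. -/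
theorem exists_forall_notMem_hull {I : TwoSidedIdeal A} (J : ℕ → TwoSidedIdeal A)
    (hne : (hull I).Nonempty)
    (hdense : ∀ n, ∀ V : Set (PrimitiveSpectrum A), IsOpen V → (V ∩ hull I).Nonempty →
      ((V ∩ hull I) \ hull (J n)).Nonempty) :
    ∃ t ∈ hull I, ∀ n, t ∉ hull (J n) := by
  let P : A × A → Prop := fun s => s.1 * s.2 = s.2 ∧ ∃ t ∈ hull I, s.2 ∉ t.1
  have hstart : ∃ s, P s := by
    obtain ⟨t, ht⟩ := hne
    obtain ⟨a, ha⟩ : ∃ a, a ∉ t.1 := by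
      obtain ⟨t, π, rfl⟩ := t
      obtain ⟨a, ha⟩ := π.nonzero
      exact ⟨a, fun h => ha (IrreducibleRep.mem_kernel.1 h)⟩
    obtain ⟨e, -, p, -, -, hep, hpt⟩ :=
      exists_local_unit t (IsSelfAdjoint.mul_star_self a) (mul_star_self_notMem t ha)
    exact ⟨(e, p), hep, t, ht, hpt⟩
  have hstep : ∀ n, ∀ s : {s // P s}, ∃ s' : {s // P s},
      s.1.1 * s'.1.1 = s'.1.1 ∧ ‖s'.1.1‖ ≤ 1 ∧ s'.1.1 ∈ J n := by
    rintro n ⟨⟨e, p⟩, hep, t₀, ht₀, hpt₀⟩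
    obtain ⟨t, ⟨hpt, htI⟩, htJ⟩ := hdense n _ (isOpen_notMem p) ⟨t₀, hpt₀, ht₀⟩
    obtain ⟨j, hj, hjt⟩ : ∃ j ∈ J n, j ∉ t.1 := by
      by_contra! h
      exact htJ fun j hj => h j hj
    obtain ⟨x, hx⟩ : ∃ x, p * x * j ∉ t.1 := by
      obtain ⟨t, π, rfl⟩ := t
      exact π.exists_mul_mul_notMem hpt hjt
    -- The left factor `p` makes `e` a left unit for the new element, and the right factor `j` puts
    -- that element in `J n`.
    set c := p * x * j with hc
    have hcJ : c * star c ∈ J n := (J n).mul_mem_right _ _ ((J n).mul_mem_left _ _ hj)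
    obtain ⟨e', h', p', rfl, hnorm, hep', hpt'⟩ :=
      exists_local_unit t (IsSelfAdjoint.mul_star_self c) (mul_star_self_notMem t hx)
    refine ⟨⟨(_, p'), hep', t, htI, hpt'⟩, ?_, hnorm, (J n).mul_mem_right _ _ hcJ⟩
    change e * (c * star c * h') = c * star c * h'
    rw [← mul_assoc, ← mul_assoc, hc, ← mul_assoc, ← mul_assoc]
    change e * p = p at hep
    rw [hep]
  choose next hnext using hstep
  obtain ⟨s₀, hs₀⟩ := hstart
  let s : ℕ → {s // P s} := fun n => Nat.rec ⟨s₀, hs₀⟩ next n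
  have hs : ∀ n, s (n + 1) = next n (s n) := fun _ => rfl
  let e : ℕ → A := fun n => (s (n + 1)).1.1
  have heJ : ∀ n, e n ∈ J n := fun n => (hnext n (s n)).2.2
  have henorm : ∀ n, ‖e n‖ ≤ 1 := fun n => (hnext n (s n)).2.1
  have hesucc : ∀ n, e n * e (n + 1) = e (n + 1) := fun n => (hnext (n + 1) (s (n + 1))).1
  have hemul : ∀ k n, k < n → e k * e n = e n := by
    intro k n hkn
    induction n, hkn using Nat.le_induction with
    | base => exact hesucc k
    | succ n hn ih => rw [← hesucc n, ← mul_assoc, ih]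
  -- Vanishing on `N`, the common kernel of the irreducible representations that kill `I`, keeps the
  -- limit representation in `hull I`.
  let N : Set (Unitization ℂ A) :=
    {x | ∀ π : IrreducibleRep A, I ≤ π.kernel → π.unital x = 0}
  have hN : ∀ x ∈ N, ∀ a b, a * x * b ∈ N := fun x hx a b π hπ => by
    rw [map_mul, map_mul, hx π hπ, mul_zero, zero_mul]
  let u : ℕ → Unitization ℂ A := fun n => (e n : Unitization ℂ A)
  have hu : ∀ n, ‖u n‖ ≤ 1 := fun n => by
    rw [Unitization.norm_inr]
    exact henorm n
  have hfin : ∀ n, (stateFace N fun k : Fin (n + 1) => u k).Nonempty := by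
    intro n
    obtain ⟨hep, ⟨t, π, rfl⟩, htI, hpt⟩ := (s (n + 1)).2
    have hk : ∀ k ≤ n, e k * (s (n + 1)).1.2 = (s (n + 1)).1.2 := fun k hk => by
      rcases hk.eq_or_lt with rfl | hlt
      · exact hep
      · rw [← hep, ← mul_assoc]
        exact congrArg (· * _) (hemul k n hlt)
    obtain ⟨v, hv⟩ : ∃ v, π.toHom (s (n + 1)).1.2 v ≠ 0 := by
      by_contra! h
      exact hpt (IrreducibleRep.mem_kernel.2 (ContinuousLinearMap.ext h))
    -- This vector is fixed by `e 0, …, e n`, so its normalized vector state takes the value `1` at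
    -- all of them.
    set w := π.toHom (s (n + 1)).1.2 v with hw
    have hw0 : ‖w‖ ≠ 0 := norm_ne_zero_iff.2 hv
    have hunit : ‖((‖w‖⁻¹ : ℝ) : ℂ) • w‖ = 1 := by
      rw [norm_smul, Complex.norm_real, norm_inv, norm_norm, inv_mul_cancel₀ hw0]
    have hst := isState_inner π.unital hunit
    refine ⟨_, hst, fun x hx => ?_, fun k => ?_⟩
    · simp [hx π htI]
    · have h1 : π.toHom (e k) w = w := by
        rw [hw, ← mul_apply_eq_comp, ← map_mul, hk k (Nat.lt_succ_iff.1 k.2)]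
      have h2 := hst.map_one
      simp only [map_one, one_apply_eq_self] at h2
      simp only [u, π.unital_inr, map_smul, h1]
      exact h2
  have hface : (stateFace N u).Nonempty := by
    have h := IsCompact.nonempty_iInter_of_sequence_nonempty_isCompact_isClosed
      (fun n => stateFace N fun k : Fin (n + 1) => u k)
      (fun n f hf => ⟨hf.1, hf.2.1, fun k => hf.2.2 ⟨k, k.2.trans (Nat.lt_succ_self _)⟩⟩)
      hfin (isCompact_stateFace N _) (fun n => isClosed_stateFace N _)
    obtain ⟨f, hf⟩ := h
    rw [Set.mem_iInter] at hf
    exact ⟨f, (hf 0).1, (hf 0).2.1, fun n => (hf n).2.2 ⟨n, Nat.lt_succ_self n⟩⟩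
  obtain ⟨f, hf⟩ := (isCompact_stateFace N u).extremePoints_nonempty hface
  obtain ⟨H, _, _, _, σ, ξ, hσ, hd⟩ := hf.1.1.exists_gns
  obtain ⟨hker, hirr⟩ := irreducible_of_mem_extremePoints hN hu hf σ ξ hσ hd
  have hσu : ∀ n, σ (u n) ≠ 0 := fun n h => by
    have := hf.1.2.2 n
    rw [hσ, h] at this
    simp at this
  let ρ : IrreducibleRep A :=
    { H := H
      toHom := (σ : Unitization ℂ A →⋆ₙₐ[ℂ] (H →L[ℂ] H)).comp
        (Unitization.inrNonUnitalStarAlgHom ℂ A)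
      nonzero := ⟨e 0, hσu 0⟩
      -- The unitization adds only scalars, so subspaces invariant under `A` are invariant under it.
      irreducible := fun K hK hinv => hirr K hK fun x v hv => by
        have h1 : σ x = x.fst • 1 + σ (x.snd : Unitization ℂ A) := by
          conv_lhs => rw [← Unitization.inl_fst_add_inr_snd_eq x]
          rw [map_add, ← Unitization.algebraMap_eq_inl, AlgHomClass.commutes,
            Algebra.algebraMap_eq_smul_one]
        rw [h1]
        exact K.add_mem (K.smul_mem _ hv) (hinv x.snd v hv) }
  have hρ : ∀ a, a ∈ ρ.kernel ↔ σ (a : Unitization ℂ A) = 0 := fun a =>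
    IrreducibleRep.mem_kernel
  refine ⟨⟨ρ.kernel, ρ, rfl⟩, fun a ha => (hρ a).2 (hker _ fun π hπ => ?_), fun n hn => ?_⟩
  · rw [π.unital_inr]
    exact IrreducibleRep.mem_kernel.1 (hπ ha)
  · exact hσu n ((hρ _).1 (hn (heJ n)))

/-! ### Order and countable ordinals -/

section Order

variable {X : Type u} [TopologicalSpace X]

theorem isOpen_orderLE (w : X → ℕ∞) (α : Ordinal.{u}) : IsOpen (orderLE w α) := by
  rw [isOpen_iff_mem_nhds]
  intro x hx
  obtain ⟨U, hU, n, hn⟩ := mem_orderLE.1 hx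
  filter_upwards [interior_mem_nhds.2 hU] with y hy
  exact mem_orderLE.2 ⟨U, mem_interior_iff_mem_nhds.1 hy, n, hn⟩

theorem orderLE_anti {w w' : X → ℕ∞} (h : w ≤ w') (α : Ordinal.{u}) :
    orderLE w' α ⊆ orderLE w α := by
  induction α using WellFoundedLT.induction with
  | ind α ih =>
    intro x hx
    obtain ⟨U, hU, n, hn⟩ := mem_orderLE.1 hx
    refine mem_orderLE.2 ⟨U, hU, n, fun y hy => (hn y hy).imp ?_ (h y).trans⟩
    rintro ⟨β, hβ, hyβ⟩
    exact ⟨β, hβ, ih β hβ hyβ⟩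

theorem weightRank_le_of_mem_orderLE {w : X → ℕ∞} {α : Ordinal.{u}} {x : X}
    (hx : x ∈ orderLE w α) :
    weightRank w x ≤ ((ω * Order.succ α : Ordinal.{u}) : WithTop Ordinal.{u}) := by
  have := (weightRank_le_iff (w := w) (x := x) (α := Order.succ α) (n := 0)).2
    (Or.inl ⟨α, Order.lt_succ α, hx⟩)
  simpa using this

end Order

theorem lt_omega_one_iff {α : Ordinal.{u}} : α < ω₁ ↔ α.card ≤ Cardinal.aleph0 := by
  rw [← Cardinal.ord_aleph, Cardinal.lt_ord, ← Cardinal.succ_aleph0, Order.lt_succ_iff]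

theorem not_countable_Iio_omega_one : ¬ (Set.Iio (ω₁ : Ordinal.{u})).Countable := by
  rw [← Cardinal.le_aleph0_iff_set_countable, Cardinal.mk_Iio_ordinal, Cardinal.lift_le_aleph0,
    ← lt_omega_one_iff]
  exact lt_irrefl _

theorem omega0_mul_succ_lt_omega_one {α : Ordinal.{u}} (h : α < ω₁) :
    ω * Order.succ α < ω₁ := by
  rw [lt_omega_one_iff] at h ⊢
  rw [Ordinal.card_mul, Ordinal.card_omega0]
  refine (mul_le_mul_right ?_ _).trans Cardinal.aleph0_mul_aleph0.le
  rw [Order.succ_eq_add_one, Ordinal.card_add, Ordinal.card_one]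
  simpa using h

/-- In a second countable space, an increasing family of closed sets indexed by the countable
ordinals has a term that equals its successor. -/
theorem exists_succ_subset {Y : Type*} [TopologicalSpace Y] [SecondCountableTopology Y]
    (C : Ordinal.{u} → Set Y) (hC : ∀ α, IsClosed (C α)) (hmono : Monotone C) :
    ∃ α < (ω₁ : Ordinal.{u}), C (Order.succ α) ⊆ C α := by
  by_contra! hcon
  -- A basic open set that meets `C (α + 1)` but misses `C α` determines `α`, so a strictly growing
  -- family would embed `ω₁` in a countable basis.
  have h : ∀ α : Set.Iio (ω₁ : Ordinal.{u}), ∃ s ∈ TopologicalSpace.countableBasis Y,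
      (∃ x ∈ s, x ∈ C (Order.succ α)) ∧ s ⊆ (C α)ᶜ := by
    rintro ⟨α, hα⟩
    obtain ⟨x, hx, hx'⟩ := Set.not_subset.1 (hcon α hα)
    obtain ⟨s, hs, hxs, hsub⟩ := (TopologicalSpace.isBasis_countableBasis Y).exists_subset_of_mem_open
      (show x ∈ (C α)ᶜ from hx') (hC α).isOpen_compl
    exact ⟨s, hs, ⟨x, hxs, hx⟩, hsub⟩
  choose s hs hsC hsub using h
  have hlt : ∀ α β, α < β → s α ≠ s β := by
    intro α β hαβ heq
    obtain ⟨x, hx, hxC⟩ := hsC α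
    rw [heq] at hx
    exact hsub β hx (hmono (Order.succ_le_of_lt hαβ) hxC)
  have hinj : Function.Injective s := by
    intro α β heq
    rcases lt_trichotomy α β with h | h | h
    · exact absurd heq (hlt α β h)
    · exact h
    · exact absurd heq.symm (hlt β α h)
  refine not_countable_Iio_omega_one (Set.countable_coe_iff.1 ?_)
  have := (TopologicalSpace.countable_countableBasis Y).to_subtype
  exact Function.Injective.countable (f := fun α => (⟨s α, hs α⟩ : TopologicalSpace.countableBasis Y))
    fun α β h => hinj (congrArg Subtype.val h)

/-! ### Preliminary algebras -/

/-- The function `Ker ρ ↦ dim ρ`, as a supremum over the representations with the given kernel. -/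
noncomputable def dimFunction (t : PrimitiveSpectrum A) : ℕ∞ :=
  ⨆ π : {π : IrreducibleRep A // π.kernel = t.1}, Cardinal.toENat (Module.rank ℂ π.1.H)

theorem pedersenFunction_le_dimFunction (a : A) : pedersenFunction a ≤ dimFunction := fun _ =>
  iSup_mono fun _ => OrderHomClass.mono Cardinal.toENat (LinearMap.rank_le_range _)

theorem IsPreliminary.hull_idealOf_dimLE (h : IsPreliminary A) (n : ℕ) :
    hull (idealOf (dimLE A n)) = dimLE A n := by
  refine Set.Subset.antisymm ?_ (subset_hull_idealOf _)
  rintro ⟨t, π, rfl⟩ ht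
  have := h π
  exact ⟨π, rfl, this, π.finrank_le_of_sInf_dimLE_le ht⟩

/-- The dimension bound depends only on the kernel, so it passes to every other representation in
the supremum. -/
theorem IsPreliminary.dimFunction_le (h : IsPreliminary A) {n : ℕ} {t : PrimitiveSpectrum A}
    (ht : t ∈ dimLE A n) : dimFunction t ≤ n := by
  refine iSup_le ?_
  rintro ⟨π, hπ⟩
  have := h π
  rw [Cardinal.toENat_le_natCast, ← Module.finrank_eq_rank, Nat.cast_le]
  refine π.finrank_le_of_sInf_dimLE_le ?_
  rw [hπ]
  exact subset_hull_idealOf _ ht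

theorem IsPreliminary.exists_orderLE_eq_univ [TopologicalSpace.SeparableSpace A]
    (h : IsPreliminary A) :
    ∃ α < (ω₁ : Ordinal.{u}), orderLE (dimFunction (A := A)) α = Set.univ := by
  have := UniformSpace.secondCountable_of_separable A
  set O := orderLE (dimFunction (A := A)) with hO
  have hhull : ∀ α, hull (idealOf (O α)ᶜ) = (O α)ᶜ := fun α =>
    hull_idealOf (by rw [compl_compl]; exact isOpen_orderLE _ α)
  obtain ⟨α, hα, hsub⟩ := exists_succ_subset (fun α => (idealOf (O α)ᶜ : Set A))
    (fun α => isClosed_idealOf _) (fun α β hαβ a ha => mem_idealOf.2 fun t ht =>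
      mem_idealOf.1 ha t fun ht' => ht (orderLE_mono hαβ ht'))
  refine ⟨α, hα, ?_⟩
  have hsucc : O (Order.succ α) ⊆ O α := by
    rw [← Set.compl_subset_compl]
    intro t ht
    rw [← hhull α] at ht
    rw [← hhull (Order.succ α)]
    exact fun a ha => ht (hsub ha)
  by_contra hne
  obtain ⟨t, -, htn⟩ := exists_forall_notMem_hull (I := idealOf (O α)ᶜ)
    (fun n => idealOf (dimLE A n)) (by rwa [hhull, Set.nonempty_compl]) (by
      rintro n V hV ⟨t, htV, ht⟩
      rw [hhull, h.hull_idealOf_dimLE]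
      rw [hhull] at ht
      by_contra hemp
      rw [Set.not_nonempty_iff_eq_empty, Set.sdiff_eq_empty] at hemp
      -- On `V` every point lies in `O α` or has dimension at most `n`; this is exactly order at
      -- most `α + 1`.
      refine ht (hsucc (mem_orderLE.2 ⟨V, hV.mem_nhds htV, n, fun y hy => ?_⟩))
      by_cases hyO : y ∈ O α
      · exact Or.inl ⟨α, Order.lt_succ α, hyO⟩
      · exact Or.inr (h.dimFunction_le (hemp ⟨hy, hyO⟩)))
  obtain ⟨t, π, rfl⟩ := t
  have hfd := h π
  refine htn (Module.finrank ℂ π.H) (subset_hull_idealOf _ ?_)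
  exact ⟨π, rfl, hfd, le_rfl⟩

theorem IsPreliminary.algebraRank_lt [TopologicalSpace.SeparableSpace A] (h : IsPreliminary A) :
    algebraRank A < ((ω₁ : Ordinal.{u}) : WithTop Ordinal.{u}) := by
  obtain ⟨α, hα, huniv⟩ := h.exists_orderLE_eq_univ
  refine lt_of_le_of_lt (b := ((ω * Order.succ α : Ordinal.{u}) : WithTop Ordinal.{u})) ?_
    (WithTop.coe_lt_coe.2 (omega0_mul_succ_lt_omega_one hα))
  refine iSup_le fun a => iSup_le fun t => weightRank_le_of_mem_orderLE ?_
  refine orderLE_anti (pedersenFunction_le_dimFunction a) α ?_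
  rw [huniv]
  trivial

/-! ### Algebras with an infinite-dimensional irreducible representation -/

theorem algebraRank_eq_top_of_opRank_eq_top (π : IrreducibleRep A) {a : A}
    (h : π.opRank a = ⊤) : algebraRank A = ⊤ := by
  let t : PrimitiveSpectrum A := ⟨π.kernel, π, rfl⟩
  have h1 : pedersenFunction a t = ⊤ :=
    top_le_iff.1 (h ▸ le_iSup (fun π : {π : IrreducibleRep A // π.kernel = t.1} => π.1.opRank a)
      ⟨π, rfl⟩)
  have h2 : weightRank (pedersenFunction a) t = ⊤ := by
    rw [weightRank, weightOrder_eq_top h1, WithTop.map_top]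
  have h3 : elementRank a = ⊤ :=
    top_le_iff.1 (h2 ▸ le_iSup (fun s => weightRank (pedersenFunction a) s) t)
  exact top_le_iff.1 (h3 ▸ le_iSup (fun b : A => elementRank b) a)

theorem rank_sub_le {V : Type u} [AddCommGroup V] [Module ℂ V] (f g : V →ₗ[ℂ] V) :
    (f - g).rank ≤ f.rank + g.rank := by
  rw [sub_eq_add_neg]
  refine (LinearMap.rank_add_le _ _).trans_eq ?_
  rw [LinearMap.rank, LinearMap.rank, LinearMap.rank, LinearMap.range_neg]

theorem IrreducibleRep.continuous_toHom (π : IrreducibleRep A) : Continuous π.toHom :=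
  (NonUnitalStarAlgHom.instContinuousLinearMapClassComplex (F := A →⋆ₙₐ[ℂ] (π.H →L[ℂ] π.H))
    (A := A) (B := π.H →L[ℂ] π.H)).map_continuous π.toHom

/-- If all operators of an irreducible representation have finite rank, their ranks are bounded. -/
theorem IrreducibleRep.exists_rank_le (π : IrreducibleRep A) (h : ∀ a, π.opRank a ≠ ⊤) :
    ∃ N : ℕ, ∀ a, (π.toHom a).toLinearMap.rank ≤ N := by
  -- Closed because rank is lower semicontinuous. Some `C n` then contains a ball; differences bound
  -- the rank near `0` by `n + n`, and scaling extends the bound to all of `A`.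
  let C : ℕ → Set A := fun n => {a | (π.toHom a).toLinearMap.rank ≤ n}
  have hclosed : ∀ n, IsClosed (C n) := fun n => by
    have : (C n)ᶜ = π.toHom ⁻¹' {f | ((n + 1 : ℕ) : Cardinal) ≤ f.toLinearMap.rank} := by
      ext a
      simp only [C, Set.mem_compl_iff, Set.mem_ofPred_eq, Set.mem_preimage, not_le]
      rw [Nat.cast_succ, ← Cardinal.succ_natCast, Order.succ_le_iff]
    rw [← isOpen_compl_iff, this]
    exact (isOpen_setOfPred_nat_le_rank (n + 1)).preimage π.continuous_toHom
  obtain ⟨n, a₀, ha₀⟩ := nonempty_interior_of_iUnion_of_closed hclosed (by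
    refine Set.eq_univ_of_forall fun a => Set.mem_iUnion.2 ?_
    obtain ⟨n, hn⟩ := ENat.ne_top_iff_exists.1 (h a)
    exact ⟨n, Cardinal.toENat_le_natCast.1 hn.ge⟩)
  obtain ⟨ε, hε, hball⟩ := Metric.isOpen_iff.1 isOpen_interior a₀ ha₀
  have hsub : ∀ a, ‖a‖ < ε → (π.toHom a).toLinearMap.rank ≤ (n + n : ℕ) := fun a ha => by
    have h1 : a₀ + a ∈ C n := interior_subset (hball (by simpa [Metric.mem_ball] using ha))
    have h2 : a₀ ∈ C n := interior_subset ha₀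
    have h3 : (π.toHom a).toLinearMap = (π.toHom (a₀ + a)).toLinearMap - (π.toHom a₀).toLinearMap := by
      rw [map_add]
      ext v
      simp
    rw [h3, Nat.cast_add]
    exact (rank_sub_le _ _).trans (add_le_add h1 h2)
  refine ⟨n + n, fun a => ?_⟩
  obtain ⟨c, hc, hca⟩ : ∃ c : ℂ, c ≠ 0 ∧ ‖c • a‖ < ε := by
    have h0 : (fun c : ℂ => ‖c • a‖) 0 < ε := by simpa using hε
    have hcont : Continuous fun c : ℂ => ‖c • a‖ := by fun_prop
    obtain ⟨c, hc, hc'⟩ := ((hcont.tendsto 0).eventually_lt_const h0).filter_mono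
      nhdsWithin_le_nhds |>.and (self_mem_nhdsWithin (s := {(0 : ℂ)}ᶜ)) |>.exists
    exact ⟨c, hc', hc⟩
  have h1 := hsub _ hca
  rwa [map_smul, ContinuousLinearMap.toLinearMap_smul, LinearMap.rank,
    LinearMap.range_smul _ _ hc] at h1

/-- An irreducible representation on an infinite-dimensional space has operators of arbitrarily
large rank. -/
theorem IrreducibleRep.exists_le_rank (π : IrreducibleRep A) (h : ¬ FiniteDimensional ℂ π.H)
    (N : ℕ) : ∃ a, (N : Cardinal) ≤ (π.toHom a).toLinearMap.rank := by
  let _ : PartialOrder A := CStarAlgebra.spectralOrder A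
  have _ : StarOrderedRing A := CStarAlgebra.spectralOrderedRing A
  let l := CStarAlgebra.approximateUnit A
  have hl : l.IsIncreasingApproximateUnit := CStarAlgebra.increasingApproximateUnit A
  have := hl.neBot
  -- The vectors on which the approximate unit converges to the identity. `V` contains every range
  -- `π a`, hence is dense, hence is infinite-dimensional.
  let V : Submodule ℂ π.H :=
    { carrier := {v | Filter.Tendsto (fun e => π.toHom e v) l (nhds v)}
      add_mem' := fun hv hw => by
        simpa only [Set.mem_ofPred_eq, map_add] using! Filter.Tendsto.add hv hw
      zero_mem' := by simp
      smul_mem' := fun c v hv => by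
        simpa only [Set.mem_ofPred_eq, map_smul] using! Filter.Tendsto.const_smul hv c }
  have hrange : ∀ a v, π.toHom a v ∈ V := fun a v => by
    have h1 := (π.continuous_toHom.tendsto a).comp (hl.tendsto_mul_right a)
    have h2 := (ContinuousLinearMap.apply ℂ π.H v).continuous.tendsto (π.toHom a) |>.comp h1
    refine h2.congr fun e => ?_
    simp
  have hdense : V.topologicalClosure = ⊤ := by
    refine (π.irreducible _ V.isClosed_topologicalClosure fun a v _ =>
      V.le_topologicalClosure (hrange a v)).resolve_left fun hbot => ?_
    obtain ⟨a, ha⟩ := π.nonzero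
    refine ha (ContinuousLinearMap.ext fun v => ?_)
    exact (Submodule.mem_bot ℂ).1 (hbot ▸ V.le_topologicalClosure (hrange a v))
  have hV : ¬ FiniteDimensional ℂ V := fun hfd => by
    have hcl : IsClosed (V : Set π.H) := Submodule.closed_of_finiteDimensional V
    rw [hcl.submodule_topologicalClosure_eq] at hdense
    rw [hdense] at hfd
    exact h (Submodule.topEquiv.finiteDimensional)
  have hN : (N : Cardinal) ≤ Module.rank ℂ V := by
    refine (Cardinal.natCast_le_aleph0).trans ?_
    rw [← not_lt, Module.rank_lt_aleph0_iff]
    exact hV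
  obtain ⟨v, hv⟩ := exists_linearIndependent_of_le_rank hN
  have hv' : LinearIndependent ℂ fun i => (v i : π.H) :=
    hv.map' V.subtype (Submodule.ker_subtype V)
  -- Linear independence of a finite family is an open condition, so it survives applying some
  -- element close enough to the identity on these vectors.
  have htend : Filter.Tendsto (fun e : A => fun i => π.toHom e (v i : π.H)) l
      (nhds fun i => (v i : π.H)) := tendsto_pi_nhds.2 fun i => (v i).2
  obtain ⟨a, ha⟩ := (htend.eventually (isOpen_setOfPred_linearIndependent.mem_nhds hv')).exists
  refine ⟨a, Module.le_rank_iff.2 ⟨fun i => ⟨π.toHom a (v i), ⟨v i, rfl⟩⟩, ?_⟩⟩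
  exact LinearIndependent.of_comp (Submodule.subtype _) ha

theorem isPreliminary_of_algebraRank_ne_top (h : algebraRank A ≠ ⊤) : IsPreliminary A := by
  intro π
  by_contra hπ
  obtain ⟨N, hN⟩ := π.exists_rank_le fun a ha => h (algebraRank_eq_top_of_opRank_eq_top π ha)
  obtain ⟨a, ha⟩ := π.exists_le_rank hπ (N + 1)
  have := Nat.cast_le.1 (ha.trans (hN a))
  omega

end PedersenRank

theorem mainTheorem2 {A : Type u} [NonUnitalCStarAlgebra A] [TopologicalSpace.SeparableSpace A] :
    (PedersenRank.IsPreliminary A ↔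
      ∃ α : Ordinal.{u}, α < ω₁ ∧ PedersenRank.IsSubhomogeneous A α) ∧
    (PedersenRank.IsPreliminary A ↔
      PedersenRank.algebraRank A < ((ω₁ : Ordinal.{u}) : WithTop Ordinal.{u})) := by
  have h : PedersenRank.IsPreliminary A ↔
      PedersenRank.algebraRank A < ((ω₁ : Ordinal.{u}) : WithTop Ordinal.{u}) :=
    ⟨fun h => h.algebraRank_lt, fun h =>
      PedersenRank.isPreliminary_of_algebraRank_ne_top h.ne_top⟩
  refine ⟨h.trans ⟨fun hlt => ?_, ?_⟩, h⟩
  · obtain ⟨α, hα⟩ := WithTop.ne_top_iff_exists.1 hlt.ne_top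
    rw [← hα, WithTop.coe_lt_coe] at hlt
    exact ⟨α, hlt, hα.ge⟩
  · rintro ⟨α, hα, hle⟩
    exact lt_of_le_of_lt hle (WithTop.coe_lt_coe.2 hα)
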